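/- Let $(X,d)$ be a complete metric space, $m,n\ge 1$ integers, and equip $X^m$ with the maximum metric $d_m$. Let $\mathcal F=\{f_1,\dots,f_n\}$ be a generalized iterated function system (GIFS) of order $m$ on $X$: each $f_i:X^m\to X$ is a generalized Matkowski contraction, i.e. there is a nondecreasing $\varphi_i:[0,\infty)\to[0,\infty)$ with $\varphi_i^{(r)}(t)\to 0$ as $r\to\infty$ for every $t>0$ and $d(f_i(x),f_i(y))\le\varphi_i(d_m(x,y))$ for all $x,y\in X^m$. Enumerate pairs of positive integers by $H(1,1):=1$ and, when $H(j,k)$ is defined: if $m\nmid j$, then $H(m^{k-1}j+1,1):=H(j,k)+1$; if $m\mid j$, then $H(\tfrac jm,k+1):=H(j,k)+1$. (For $m\ge 2$ this is a bijection from pairs of positive integers onto the positive integers; for $m=1$ it is defined only at the pairs $(1,k)$, with $H(1,k)=k$.) For $x_0\in X$ and $(\gamma_i)_{i\ge1}\in\{1,\dots,n\}^{\mathbb N}$ define the chaos game sequence $(x_i)_{i\ge 0}$ as follows. For $1\le i\le m$, $x_i:=f_{\gamma_i}(x_0,\dots,x_0)$. For $i>m$ write $i=H(j,k)$; if $k>1$,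 then $$x_i:=f_{\gamma_i}\bigl(x_{H(mj-m+1,k-1)},\dots,x_{H(mj,k-1)}\bigr),$$ and if $k=1$, then $x_i:=f_{\gamma_i}(x_l,\dots,x_l)$, where $l=H(j',k')$ is the largest number with $l<i$ and $k'>1$. Let $p_1,\dots,p_n>0$ with $p_1+\dots+p_n=1$, and equip $\{1,\dots,n\}^{\mathbb N}$ with the product of the probability measures given by $P(\{i\})=p_i$. Then there is a unique nonempty compact set $A_{\mathcal F}\subset X$ with $A_{\mathcal F}=\bigcup_{i=1}^n f_i(A_{\mathcal F}\times\dots\times A_{\mathcal F})$. Moreover, for every $x_0\in X$, with probability $1$ with respect to $(\gamma_i)$, the sets $K_k:=\overline{\{x_i:i\ge k\}}$, $k\ge 0$, are compact and converge to $A_{\mathcal F}$ in the Hausdorff–Pompeiu metric as $k\to\infty$; and if $x_0\in A_{\mathcal F}$, then with probability $1$ $K_k=A_{\mathcal F}$ for every $k\ge 0$. -/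

import Mathlib

open Set Filter Topology MeasureTheory
open scoped NNReal ENNReal

/-- A generalized Matkowski contraction of order `m`: for some nondecreasing
`φ : [0, ∞) → [0, ∞)` whose iterates tend to `0` at every `t > 0`,
`d (g x, g y) ≤ φ (d_m (x, y))`. The distance of `Fin m → X` is the maximum metric. -/
def IsGenMatkowskiContraction {X : Type*} [MetricSpace X] {m : ℕ}
    (g : (Fin m → X) → X) : Prop :=
  ∃ φ : ℝ≥0 → ℝ≥0, Monotone φ ∧
    (∀ t : ℝ≥0, 0 < t → Tendsto (fun k : ℕ => φ^[k] t) atTop (𝓝 0)) ∧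
    ∀ x y : Fin m → X, nndist (g x) (g y) ≤ φ (nndist x y)

/-- The set map `(K_1, …, K_m) ↦ f_1 (K_1 × … × K_m) ∪ … ∪ f_n (K_1 × … × K_m)`. -/
def gifsMap {X : Type*} {m n : ℕ} (f : Fin n → (Fin m → X) → X)
    (K : Fin m → Set X) : Set X :=
  ⋃ i : Fin n, f i '' (Set.univ.pi K)

/-- `A` is a nonempty compact set with `A = F(A, …, A)`. -/
def IsGIFSAttractor {X : Type*} [MetricSpace X] {m n : ℕ}
    (f : Fin n → (Fin m → X) → X) (A : Set X) : Prop :=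
  A.Nonempty ∧ IsCompact A ∧ A = gifsMap f (fun _ => A)

/-- The successor of the pair `(j, k)`: `H` takes at `chaosNext m (j, k)` the value
`H (j, k) + 1`. -/
def chaosNext (m : ℕ) (q : ℕ × ℕ) : ℕ × ℕ :=
  if q.1 % m ≠ 0 then (m ^ (q.2 - 1) * q.1 + 1, 1) else (q.1 / m, q.2 + 1)

/-- The pair `(j, k)` with `H (j, k) = i`, for `i ≥ 1`: the enumeration starts with
`(1, 1)` at `i = 1`. The value at `i = 0` is not used. -/
def chaosNode (m i : ℕ) : ℕ × ℕ :=
  (chaosNext m)^[i - 1] (1, 1)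

/-- The map `H`, the inverse of the enumeration `chaosNode m` of pairs of positive integers:
`H (1, 1) = 1`, and `H (chaosNext m (j, k)) = H (j, k) + 1`. -/
noncomputable def chaosH (m j k : ℕ) : ℕ :=
  sInf {i : ℕ | 1 ≤ i ∧ chaosNode m i = (j, k)}

theorem chaosNode_one (m : ℕ) : chaosNode m 1 = (1, 1) := rfl

theorem chaosNode_succ (m i : ℕ) (hi : 1 ≤ i) :
    chaosNode m (i + 1) = chaosNext m (chaosNode m i) := by
  obtain ⟨r, rfl⟩ : ∃ r, i = r + 1 := ⟨i - 1, by omega⟩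
  simp only [chaosNode, Nat.add_sub_cancel]
  exact Function.iterate_succ_apply' _ _ _

/-- When the enumeration stands at `(u + 1, k)`, it has already visited all left siblings of
that node and of each of its ancestors. -/
theorem chaosNode_inv (m : ℕ) (hm : 1 ≤ m) (i : ℕ) (hi : 1 ≤ i) :
    ∃ u k : ℕ, 1 ≤ k ∧ chaosNode m i = (u + 1, k) ∧
      ∀ e s : ℕ, s < (u / m ^ e) % m →
        ∃ l, 1 ≤ l ∧ l ≤ i ∧ chaosNode m l = (m * (u / m ^ e / m) + s + 1, k + e) := by
  induction i, hi using Nat.le_induction with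
  | base => exact ⟨0, 1, le_rfl, rfl, fun e s hs => by simp at hs⟩
  | succ i hi ih =>
    obtain ⟨u, k, hk, hn, hv⟩ := ih
    have hstep := chaosNode_succ m i hi
    rw [hn] at hstep
    by_cases hd : (u + 1) % m = 0
    · have hdiv : (u + 1) / m = u / m + 1 := by
        rw [Nat.succ_div, if_pos (Nat.dvd_of_mod_eq_zero hd)]
      refine ⟨u / m, k + 1, by omega, ?_, ?_⟩
      · rw [hstep]; simp [chaosNext, hd, hdiv]
      · intro e s hs
        have he : u / m / m ^ e = u / m ^ (e + 1) := by
          rw [Nat.div_div_eq_div_mul, pow_succ']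
        rw [he] at hs ⊢
        obtain ⟨l, h1, h2, h3⟩ := hv (e + 1) s hs
        exact ⟨l, h1, by omega, by rw [h3]; congr 1; omega⟩
    · refine ⟨m ^ (k - 1) * (u + 1), 1, le_rfl, ?_, ?_⟩
      · rw [hstep]; simp [chaosNext, hd]
      · intro e s hs
        have hpos : 0 < m := hm
        rcases lt_trichotomy e (k - 1) with he | he | he
        · exfalso
          obtain ⟨c, hc⟩ : ∃ c, k - 1 = e + (c + 1) := ⟨k - 1 - e - 1, by omega⟩
          rw [hc, pow_add, mul_assoc, Nat.mul_div_cancel_left _ (pow_pos hpos e), pow_succ',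
            mul_assoc, Nat.mul_mod_right] at hs
          omega
        · subst he
          rw [Nat.mul_div_cancel_left _ (pow_pos hpos _)] at hs ⊢
          have hdiv : (u + 1) / m = u / m := by
            rw [Nat.succ_div, if_neg (fun h => hd (Nat.mod_eq_zero_of_dvd h)), add_zero]
          have h1 := Nat.div_add_mod (u + 1) m
          have h2 := Nat.div_add_mod u m
          rw [hdiv] at h1 ⊢
          have hke : 1 + (k - 1) = k := by omega
          rw [hke]
          by_cases hsu : s < u % m
          · obtain ⟨l, a, b, c⟩ := hv 0 s (by simpa using hsu)
            exact ⟨l, a, by omega, by simpa using c⟩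
          · refine ⟨i, hi, by omega, ?_⟩
            rw [hn]
            congr 1
            omega
        · obtain ⟨c, hc⟩ : ∃ c, e = (k - 1) + (c + 1) := ⟨e - (k - 1) - 1, by omega⟩
          have hdiv : (u + 1) / m = u / m := by
            rw [Nat.succ_div, if_neg (fun h => hd (Nat.mod_eq_zero_of_dvd h)), add_zero]
          have hq : m ^ (k - 1) * (u + 1) / m ^ e = u / m ^ (c + 1) := by
            rw [hc, pow_add, ← Nat.div_div_eq_div_mul,
              Nat.mul_div_cancel_left _ (pow_pos hpos _), pow_succ',
              ← Nat.div_div_eq_div_mul, hdiv, Nat.div_div_eq_div_mul]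
          rw [hq] at hs ⊢
          obtain ⟨l, h1, h2, h3⟩ := hv (c + 1) s hs
          exact ⟨l, h1, by omega, by rw [h3]; congr 1; omega⟩

/-- The pairs `(m j - m + 1, k - 1), …, (m j, k - 1)` come before `(j, k)`. -/
theorem chaosH_child_lt (m i t : ℕ) (ht : t < m) (hi : 1 ≤ i)
    (hk : 1 < (chaosNode m i).2) :
    chaosH m (m * (chaosNode m i).1 - m + 1 + t) ((chaosNode m i).2 - 1) < i := by
  suffices h : ∃ l, 1 ≤ l ∧ l < i ∧
      chaosNode m l = (m * (chaosNode m i).1 - m + 1 + t, (chaosNode m i).2 - 1) by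
    obtain ⟨l, h1, h2, h3⟩ := h
    exact lt_of_le_of_lt (Nat.sInf_le ⟨h1, h3⟩) h2
  rcases Nat.lt_or_ge i 2 with h2 | h2
  · obtain rfl : i = 1 := by omega
    simp [chaosNode_one] at hk
  obtain ⟨r, rfl⟩ : ∃ r, i = r + 1 := ⟨i - 1, by omega⟩
  have hr : 1 ≤ r := by omega
  obtain ⟨u, k, hk1, hn, hv⟩ := chaosNode_inv m (by omega) r hr
  have hstep := chaosNode_succ m r hr
  rw [hn] at hstep
  by_cases hd : (u + 1) % m = 0
  · have hdiv : (u + 1) / m = u / m + 1 := by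
      rw [Nat.succ_div, if_pos (Nat.dvd_of_mod_eq_zero hd)]
    have hnode : chaosNode m (r + 1) = (u / m + 1, k + 1) := by
      rw [hstep]; simp [chaosNext, hd, hdiv]
    rw [hnode]
    have h1 := Nat.div_add_mod (u + 1) m
    have h3 := Nat.div_add_mod u m
    rw [hdiv, hd, Nat.mul_add, mul_one] at h1
    have e1 : m * (u / m + 1) - m + 1 + t = m * (u / m) + t + 1 := by
      rw [Nat.mul_add, mul_one]; omega
    simp only [e1, Nat.add_sub_cancel]
    by_cases htu : t < u % m
    · obtain ⟨l, a, b, c⟩ := hv 0 t (by simpa using htu)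
      exact ⟨l, a, by omega, by simpa using c⟩
    · refine ⟨r, hr, by omega, ?_⟩
      rw [hn]
      congr 1
      omega
  · exfalso
    rw [hstep] at hk
    simp [chaosNext, hd] at hk

/-- The chaos game sequence `x_0, x_1, x_2, …` driven by the symbols `γ_1, γ_2, …`
(the entry `γ 0` is not used). For `i > m` write `i = H (j, k)`. If `k > 1`, the arguments are
the points with the indices `H (m j - m + 1, k - 1), …, H (m j, k - 1)`. If `k = 1`, all arguments
are `x_l`, where `l` is the largest index below `i` whose pair has second entry above `1`. -/
noncomputable def chaosSeq {X : Type*} {m n : ℕ} (f : Fin n → (Fin m → X) → X)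
    (x₀ : X) (γ : ℕ → Fin n) (i : ℕ) : X :=
  if _h0 : i = 0 then x₀
  else if i ≤ m then f (γ i) (fun _ => x₀)
  else if _hk : 1 < (chaosNode m i).2 then
    f (γ i) (fun t : Fin m => chaosSeq f x₀ γ
      (chaosH m (m * (chaosNode m i).1 - m + 1 + t) ((chaosNode m i).2 - 1)))
  else
    f (γ i) (fun _ => chaosSeq f x₀ γ
      (Nat.findGreatest (fun l => 1 < (chaosNode m l).2) (i - 1)))
termination_by i
decreasing_by
  · exact chaosH_child_lt m i t t.isLt (by omega) _hk
  · exact lt_of_le_of_lt (Nat.findGreatest_le _) (by omega)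

/-- `K_k`, the closure of `{x_i : i ≥ k}`. -/
def chaosTail {X : Type*} [MetricSpace X] (x : ℕ → X) (k : ℕ) : Set X :=
  closure {y : X | ∃ i : ℕ, k ≤ i ∧ x i = y}

/-!
The recursion of the chaos game reads `x_i = f_{γ_i} (x_{c(i, 0)}, …, x_{c(i, m - 1)})` for every
`i ≥ 1`, with a child function `c` (`chaosChild`) that satisfies `c(i, t) < i` and
`c(i, t) → ∞` as `i → ∞`; the index `0` carries the start `x₀`.

The maps `f_i` share one comparison function `φ` (`IsMatkowskiFun.finset_sup`). Hence
`K ↦ F (K, …, K)` is a Matkowski contraction of the complete space of nonempty compact sets, and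
Matkowski's fixed point theorem gives a unique attractor `A` (`exists_unique_attractor`).

If the arguments of `x_i` are within `c` of `A`, then `x_i` is within `φ c` of `A`. As the child
indices tend to infinity, the distance of `x_i` to `A` tends to `0` for every symbol sequence
(`eventually_exists_nndist_chaosSeq_lt`), which makes the tails totally bounded. If `x₀ ∈ A`, the
whole sequence stays in `A`.

Conversely, a point `a ∈ A` is a composition of the `f_i` along an `m`-ary tree of any height `r`
with arguments in `A`, and the choice of the maps in the tree determines `a` up to
`φ^[r + 1] D`, where `D` bounds the distances between `A` and the sequence. The enumeration of the
nodes is the post-order traversal of an infinite `m`-ary tree, so that complete subtrees of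
height `r` occupy whole intervals of indices (`IsTreeBlock`), infinitely many of them
(`exists_strictMono_isTreeBlock`). A sequence of symbols on such an interval that spells the tree of
`a` brings the chaos game close to `a` (`exists_word`), and by the second Borel–Cantelli lemma every
finite word is almost surely spelled on infinitely many of the intervals (`ae_frequently_spells`).
There are countably many words, so almost surely all tails contain `A` (`ae_subset_chaosTail`).
-/

/-! ### Comparison functions and Matkowski's fixed point theorem -/

/-- A comparison function: nondecreasing, with iterates tending to `0` at every `t > 0`. -/
structure IsMatkowskiFun (φ : ℝ≥0 → ℝ≥0) : Prop where
  mono : Monotone φ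
  tendsto_iterate : ∀ t : ℝ≥0, 0 < t → Tendsto (fun k : ℕ => φ^[k] t) atTop (𝓝 0)

namespace IsMatkowskiFun

variable {φ : ℝ≥0 → ℝ≥0}

theorem lt_self (hφ : IsMatkowskiFun φ) {t : ℝ≥0} (ht : 0 < t) : φ t < t := by
  by_contra! h
  have hk : ∀ k : ℕ, t ≤ φ^[k] t := by
    intro k
    induction k with
    | zero => exact le_rfl
    | succ k ih =>
      rw [Function.iterate_succ_apply']
      exact h.trans (hφ.mono ih)
  exact absurd (ge_of_tendsto' (hφ.tendsto_iterate t ht) hk) (not_le.2 ht)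

theorem map_zero (hφ : IsMatkowskiFun φ) : φ 0 = 0 := by
  by_contra h
  have hpos : 0 < φ 0 := pos_iff_ne_zero.2 h
  exact absurd (hφ.mono hpos.le) (not_le.2 (hφ.lt_self hpos))

theorem le_self (hφ : IsMatkowskiFun φ) (t : ℝ≥0) : φ t ≤ t := by
  rcases eq_zero_or_pos t with rfl | ht
  · exact hφ.map_zero.le
  · exact (hφ.lt_self ht).le

theorem tendsto_iterate' (hφ : IsMatkowskiFun φ) (t : ℝ≥0) :
    Tendsto (fun k : ℕ => φ^[k] t) atTop (𝓝 0) := by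
  rcases eq_zero_or_pos t with rfl | ht
  · simp [Function.iterate_fixed hφ.map_zero]
  · exact hφ.tendsto_iterate t ht

/-- Otherwise `φ` would map `(L, ∞)` into itself, and the iterates could not tend to `0`. -/
theorem eventually_le (hφ : IsMatkowskiFun φ) {L : ℝ≥0} (hL : 0 < L) :
    ∀ᶠ s in 𝓝[>] L, φ s ≤ L := by
  obtain ⟨s, hs, hsL⟩ : ∃ s, L < s ∧ φ s ≤ L := by
    by_contra! h
    have hk : ∀ k : ℕ, L < φ^[k] (L + 1) := by
      intro k
      induction k with
      | zero => simp
      | succ k ih =>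
        rw [Function.iterate_succ_apply']
        exact h _ ih
    exact absurd (ge_of_tendsto' (hφ.tendsto_iterate (L + 1) (by positivity))
      fun k => (hk k).le) (not_le.2 hL)
  filter_upwards [Ioo_mem_nhdsGT hs] with x hx using (hφ.mono hx.2.le).trans hsL

/-- The two pointwise conditions `φ t < t` and `φ ≤ L` just to the right of `L` together
characterize comparison functions; unlike the condition on iterates, they pass at once to finite
suprema. -/
theorem of_lt_self (hmono : Monotone φ) (hlt : ∀ t, 0 < t → φ t < t)
    (hle : ∀ L, 0 < L → ∀ᶠ s in 𝓝[>] L, φ s ≤ L) : IsMatkowskiFun φ := by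
  refine ⟨hmono, fun t _ => ?_⟩
  have h0 : φ 0 = 0 := by
    by_contra h
    have hpos : 0 < φ 0 := pos_iff_ne_zero.2 h
    exact absurd (hmono hpos.le) (not_le.2 (hlt _ hpos))
  have hself : ∀ s, φ s ≤ s := fun s => by
    rcases eq_zero_or_pos s with rfl | hs
    · exact h0.le
    · exact (hlt s hs).le
  have hanti : Antitone fun k : ℕ => φ^[k] t := antitone_nat_of_succ_le fun k => by
    rw [Function.iterate_succ_apply']
    exact hself _
  have hlim := tendsto_atTop_ciInf hanti (OrderBot.bddBelow _)
  set L := ⨅ k : ℕ, φ^[k] t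
  have hLk : ∀ k : ℕ, L ≤ φ^[k] t := fun k => ciInf_le (OrderBot.bddBelow _) k
  rcases eq_zero_or_pos L with hL | hL
  · rwa [hL] at hlim
  exfalso
  obtain ⟨s, hsL, hs⟩ := ((hle L hL).and self_mem_nhdsWithin).exists
  obtain ⟨k, hk⟩ := (hlim.eventually (gt_mem_nhds hs)).exists
  have h1 : φ^[k + 1] t ≤ L := by
    rw [Function.iterate_succ_apply']
    exact (hmono hk.le).trans hsL
  have h2 : φ^[k + 2] t < L := by
    rw [Function.iterate_succ_apply']
    exact (hmono h1).trans_lt (hlt L hL)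
  exact absurd (hLk _) (not_le.2 h2)

theorem finset_sup {ι : Type*} [Fintype ι] {φ : ι → ℝ≥0 → ℝ≥0}
    (hφ : ∀ i, IsMatkowskiFun (φ i)) :
    IsMatkowskiFun fun t => Finset.univ.sup fun i => φ i t := by
  refine of_lt_self (fun s t hst => Finset.sup_mono_fun fun i _ => (hφ i).mono hst) ?_ ?_
  · intro t ht
    exact (Finset.sup_lt_iff ht).2 fun i _ => (hφ i).lt_self ht
  · intro L hL
    filter_upwards [eventually_all.2 fun i => (hφ i).eventually_le hL] with s hs
    exact Finset.sup_le fun i _ => hs i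

theorem eq_of_nndist_le {Y : Type*} [MetricSpace Y] (hφ : IsMatkowskiFun φ) {x y : Y}
    (h : nndist x y ≤ φ (nndist x y)) : x = y := by
  by_contra hne
  exact absurd h (not_le.2 (hφ.lt_self (pos_iff_ne_zero.2 fun h0 => hne (nndist_eq_zero.1 h0))))

/-- Matkowski's fixed point theorem. Once consecutive iterates of `G` are closer than `ε - φ ε`,
the closed `ε`-ball around an iterate is mapped into itself, so the iterates form a Cauchy
sequence. -/
theorem exists_fixedPoint {Y : Type*} [MetricSpace Y] [CompleteSpace Y] [Nonempty Y]
    (hφ : IsMatkowskiFun φ) {G : Y → Y} (hG : ∀ x y, nndist (G x) (G y) ≤ φ (nndist x y)) :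
    ∃ x, G x = x := by
  obtain ⟨y⟩ := ‹Nonempty Y›
  have hlip : LipschitzWith 1 G := LipschitzWith.of_dist_le_mul fun a b => by
    rw [NNReal.coe_one, one_mul]
    exact_mod_cast (hG a b).trans (hφ.le_self _)
  have hstep : ∀ r : ℕ, nndist (G^[r] y) (G^[r + 1] y) ≤ φ^[r] (nndist y (G y)) := by
    intro r
    induction r with
    | zero => exact le_rfl
    | succ r ih =>
      rw [Function.iterate_succ_apply', Function.iterate_succ_apply' G (r + 1),
        Function.iterate_succ_apply' φ]
      exact (hG _ _).trans (hφ.mono ih)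
  have hcauchy : CauchySeq fun r : ℕ => G^[r] y := by
    refine Metric.cauchySeq_iff'.2 fun ε hε => ?_
    lift ε to ℝ≥0 using hε.le
    have hε' : 0 < ε / 2 := half_pos (by exact_mod_cast hε)
    have hgap : 0 < ε / 2 - φ (ε / 2) := tsub_pos_of_lt (hφ.lt_self hε')
    obtain ⟨N, hN⟩ :=
      ((hφ.tendsto_iterate' (nndist y (G y))).eventually (gt_mem_nhds hgap)).exists
    have hball : ∀ k : ℕ, nndist (G^[N + k] y) (G^[N] y) ≤ ε / 2 := by
      intro k
      induction k with
      | zero => simp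
      | succ k ih =>
        calc nndist (G^[N + k + 1] y) (G^[N] y)
            ≤ nndist (G^[N + k + 1] y) (G^[N + 1] y) + nndist (G^[N + 1] y) (G^[N] y) :=
              nndist_triangle _ _ _
          _ ≤ φ (ε / 2) + (ε / 2 - φ (ε / 2)) := by
              refine add_le_add ?_ ?_
              · rw [Function.iterate_succ_apply', Function.iterate_succ_apply']
                exact (hG _ _).trans (hφ.mono ih)
              · rw [nndist_comm]
                exact (hstep N).trans hN.le
          _ = ε / 2 := add_tsub_cancel_of_le (hφ.le_self _)
    refine ⟨N, fun r hr => ?_⟩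
    obtain ⟨k, rfl⟩ := Nat.exists_eq_add_of_le hr
    have h2 : ε / 2 < ε := half_lt_self (by exact_mod_cast hε)
    exact_mod_cast (hball k).trans_lt h2
  obtain ⟨z, hz⟩ := cauchySeq_tendsto_of_complete hcauchy
  refine ⟨z, isFixedPt_of_tendsto_iterate hz hlip.continuous.continuousAt⟩

end IsMatkowskiFun

/-- Finitely many generalized Matkowski contractions share one comparison function. -/
theorem exists_common_comparison {X : Type*} [MetricSpace X] {m n : ℕ}
    {f : Fin n → (Fin m → X) → X} (hf : ∀ i, IsGenMatkowskiContraction (f i)) :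
    ∃ φ : ℝ≥0 → ℝ≥0, IsMatkowskiFun φ ∧
      ∀ i x y, nndist (f i x) (f i y) ≤ φ (nndist x y) := by
  choose φ hmono hlim hle using hf
  refine ⟨_, IsMatkowskiFun.finset_sup fun i => ⟨hmono i, hlim i⟩, fun i x y => ?_⟩
  exact (hle i x y).trans
    (Finset.le_sup (f := fun i => φ i (nndist x y)) (Finset.mem_univ i))

/-! ### The attractor -/

section Attractor

variable {X : Type*} [MetricSpace X] {m n : ℕ} {f : Fin n → (Fin m → X) → X}
  {φ : ℝ≥0 → ℝ≥0}

theorem continuous_of_nndist_le (hφ : IsMatkowskiFun φ)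
    (hf : ∀ i x y, nndist (f i x) (f i y) ≤ φ (nndist x y)) (i : Fin n) : Continuous (f i) := by
  have hlip : LipschitzWith 1 (f i) := LipschitzWith.of_dist_le_mul fun a b => by
    rw [NNReal.coe_one, one_mul]
    exact_mod_cast (hf i a b).trans (hφ.le_self _)
  exact hlip.continuous

open TopologicalSpace in
/-- The map `K ↦ F (K, …, K)` on the nonempty compact sets. -/
def gifsCompacts [NeZero n] (hf : ∀ i, Continuous (f i)) (K : NonemptyCompacts X) :
    NonemptyCompacts X where
  carrier := gifsMap f fun _ => K
  isCompact' := isCompact_iUnion fun i => (isCompact_univ_pi fun _ => K.isCompact).image (hf i)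
  nonempty' := by
    obtain ⟨a, ha⟩ := K.nonempty
    exact ⟨f 0 fun _ => a, mem_iUnion.2 ⟨0, mem_image_of_mem _ fun _ _ => ha⟩⟩

theorem exists_nndist_gifsMap_le (hφ : IsMatkowskiFun φ)
    (hf : ∀ i x y, nndist (f i x) (f i y) ≤ φ (nndist x y)) {A B : Set X} {c : ℝ≥0}
    (h : ∀ a ∈ A, ∃ b ∈ B, nndist a b ≤ c) :
    ∀ x ∈ gifsMap f (fun _ => A), ∃ y ∈ gifsMap f (fun _ => B), nndist x y ≤ φ c := by
  intro x hx
  obtain ⟨i, u, hu, rfl⟩ := mem_iUnion.1 hx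
  choose v hv hvc using fun t => h (u t) (hu t trivial)
  exact ⟨f i v, mem_iUnion.2 ⟨i, mem_image_of_mem _ fun t _ => hv t⟩,
    (hf i u v).trans (hφ.mono (nndist_pi_le_iff.2 hvc))⟩

open TopologicalSpace in
theorem nndist_gifsCompacts_le [NeZero n] (hφ : IsMatkowskiFun φ)
    (hf : ∀ i x y, nndist (f i x) (f i y) ≤ φ (nndist x y)) (K L : NonemptyCompacts X) :
    nndist (gifsCompacts (continuous_of_nndist_le hφ hf) K)
      (gifsCompacts (continuous_of_nndist_le hφ hf) L) ≤ φ (nndist K L) := by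
  have key : ∀ K L : NonemptyCompacts X, ∀ a ∈ (K : Set X), ∃ b ∈ (L : Set X),
      nndist a b ≤ nndist K L := by
    intro K L a ha
    obtain ⟨b, hb, hab⟩ := L.isCompact.exists_infDist_eq_dist L.nonempty a
    refine ⟨b, hb, ?_⟩
    have h := Metric.infDist_le_hausdorffDist_of_mem ha
      (Metric.hausdorffEDist_ne_top_of_nonempty_of_bounded K.nonempty L.nonempty
        K.isCompact.isBounded L.isCompact.isBounded)
    rw [hab] at h
    exact_mod_cast h
  have key' : ∀ K L : NonemptyCompacts X,
      ∀ x ∈ gifsMap f (fun _ => (K : Set X)), ∃ y ∈ gifsMap f (fun _ => (L : Set X)),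
        dist x y ≤ φ (nndist K L) := by
    intro K L x hx
    obtain ⟨y, hy, hxy⟩ := exists_nndist_gifsMap_le hφ hf (key K L) x hx
    exact ⟨y, hy, by exact_mod_cast hxy⟩
  have h : Metric.hausdorffDist (gifsMap f fun _ => (K : Set X)) (gifsMap f fun _ => (L : Set X)) ≤
      φ (nndist K L) := by
    refine Metric.hausdorffDist_le_of_mem_dist (NNReal.coe_nonneg _) (key' K L) ?_
    rw [nndist_comm]
    exact key' L K
  exact_mod_cast h

open TopologicalSpace in
theorem exists_unique_attractor [CompleteSpace X] [Nonempty X] [NeZero n]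
    (hφ : IsMatkowskiFun φ) (hf : ∀ i x y, nndist (f i x) (f i y) ≤ φ (nndist x y)) :
    ∃ A : Set X, IsGIFSAttractor f A ∧ ∀ B : Set X, IsGIFSAttractor f B → B = A := by
  have hne : Nonempty (NonemptyCompacts X) := ‹Nonempty X›.map fun x => {x}
  have hG := nndist_gifsCompacts_le hφ hf
  obtain ⟨A, hA⟩ := hφ.exists_fixedPoint hG
  refine ⟨A, ⟨A.nonempty, A.isCompact, congrArg SetLike.coe hA.symm⟩, ?_⟩
  rintro B ⟨hB1, hB2, hB3⟩
  set B' : NonemptyCompacts X := ⟨⟨B, hB2⟩, hB1⟩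
  have hB : gifsCompacts (continuous_of_nndist_le hφ hf) B' = B' :=
    NonemptyCompacts.ext hB3.symm
  have heq : B' = A := hφ.eq_of_nndist_le (by simpa only [hA, hB] using hG B' A)
  exact congrArg SetLike.coe heq

end Attractor

/-! ### The enumeration of the nodes -/

theorem chaosNode_eq (m : ℕ) (hm : 1 ≤ m) (i : ℕ) (hi : 1 ≤ i) :
    ∃ u k : ℕ, chaosNode m i = (u + 1, k + 1) := by
  obtain ⟨u, k, hk, h, -⟩ := chaosNode_inv m hm i hi
  obtain ⟨k, rfl⟩ := Nat.exists_eq_add_of_le' hk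
  exact ⟨u, k, h⟩

/-- The last leaf below the node `(j, k)` is `(m ^ (k - 1) * j, 1)`. A step of the enumeration
moves on to the next leaf, or keeps the last leaf and increases the height. -/
theorem chaosNode_lt_succ (m : ℕ) (hm : 1 ≤ m) (i : ℕ) (hi : 1 ≤ i) :
    toLex (m ^ ((chaosNode m i).2 - 1) * (chaosNode m i).1, (chaosNode m i).2) <
      toLex (m ^ ((chaosNode m (i + 1)).2 - 1) * (chaosNode m (i + 1)).1,
        (chaosNode m (i + 1)).2) := by
  obtain ⟨u, k, h⟩ := chaosNode_eq m hm i hi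
  rw [chaosNode_succ m i hi, h, Prod.Lex.toLex_lt_toLex]
  by_cases hd : (u + 1) % m = 0
  · right
    obtain ⟨v, hv⟩ := Nat.dvd_of_mod_eq_zero hd
    simp [chaosNext, hv, Nat.mul_div_cancel_left v hm, pow_succ, mul_assoc]
  · left
    simp [chaosNext, hd]

theorem chaosNode_injOn (m : ℕ) (hm : 1 ≤ m) : InjOn (chaosNode m) (Ici 1) := by
  have hmono : StrictMono fun r : ℕ => toLex
      (m ^ ((chaosNode m (r + 1)).2 - 1) * (chaosNode m (r + 1)).1, (chaosNode m (r + 1)).2) :=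
    strictMono_nat_of_lt_succ fun r => chaosNode_lt_succ m hm (r + 1) (by omega)
  intro i hi i' hi' h
  obtain ⟨r, rfl⟩ := Nat.exists_eq_add_of_le' (mem_Ici.1 hi)
  obtain ⟨r', rfl⟩ := Nat.exists_eq_add_of_le' (mem_Ici.1 hi')
  rw [hmono.injective (a₁ := r) (a₂ := r') (by simp only [h])]

theorem chaosH_eq (m : ℕ) (hm : 1 ≤ m) {i j k : ℕ} (hi : 1 ≤ i) (h : chaosNode m i = (j, k)) :
    chaosH m j k = i := by
  have hmem : sInf {i : ℕ | 1 ≤ i ∧ chaosNode m i = (j, k)} ∈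
      {i : ℕ | 1 ≤ i ∧ chaosNode m i = (j, k)} := Nat.sInf_mem ⟨i, hi, h⟩
  exact chaosNode_injOn m hm hmem.1 hi (hmem.2.trans h.symm)

/-- Every child of an enumerated node is enumerated, so `chaosH` takes no default value there. -/
theorem chaosNode_chaosH_child (m i u k t : ℕ) (ht : t < m) (hi : 1 ≤ i)
    (h : chaosNode m i = (u + 1, k + 2)) :
    1 ≤ chaosH m (m * u + 1 + t) (k + 1) ∧
      chaosNode m (chaosH m (m * u + 1 + t) (k + 1)) = (m * u + 1 + t, k + 1) := by
  have hm : 1 ≤ m := by omega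
  suffices hl : ∃ l, 1 ≤ l ∧ chaosNode m l = (m * u + 1 + t, k + 1) by
    obtain ⟨l, h1, h2⟩ := hl
    rw [chaosH_eq m hm h1 h2]
    exact ⟨h1, h2⟩
  rcases Nat.lt_or_ge i 2 with h2 | h2
  · obtain rfl : i = 1 := by omega
    simp [chaosNode_one] at h
  obtain ⟨r, rfl⟩ : ∃ r, i = r + 1 := ⟨i - 1, by omega⟩
  have hr : 1 ≤ r := by omega
  obtain ⟨v, k', hk', hn, hv⟩ := chaosNode_inv m hm r hr
  rw [chaosNode_succ m r hr, hn] at h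
  by_cases hd : (v + 1) % m = 0
  · have hdiv : (v + 1) / m = v / m + 1 := by
      rw [Nat.succ_div, if_pos (Nat.dvd_of_mod_eq_zero hd)]
    simp only [chaosNext, hd, hdiv, ne_eq, not_true_eq_false, if_false, Prod.mk.injEq] at h
    obtain ⟨hu, hk⟩ := h
    obtain rfl : k' = k + 1 := by omega
    obtain rfl : v / m = u := by omega
    have h1 := Nat.div_add_mod (v + 1) m
    have h3 := Nat.div_add_mod v m
    rw [hdiv, hd, Nat.mul_add, mul_one] at h1
    by_cases htu : t < v % m
    · obtain ⟨l, a, -, c⟩ := hv 0 t (by simpa using htu)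
      refine ⟨l, a, ?_⟩
      rw [c, pow_zero, Nat.div_one]
      congr 1
      omega
    · refine ⟨r, hr, ?_⟩
      rw [hn]
      congr 1
      omega
  · simp [chaosNext, hd] at h

/-- The number of nodes of the complete `m`-ary tree of height `r`, the root not counted. -/
def treeSize (m : ℕ) : ℕ → ℕ
  | 0 => 0
  | r + 1 => m * (treeSize m r + 1)

theorem strictMono_treeSize (m : ℕ) (hm : 1 ≤ m) : StrictMono (treeSize m) :=
  strictMono_nat_of_lt_succ fun r =>
    (Nat.lt_succ_self _).trans_le (Nat.le_mul_of_pos_left (treeSize m r + 1) hm)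

/-- The subtrees of the children of a node follow one another without interruption, provided that
this is so inside each of them. -/
theorem chaosNode_child_leaf (m r u b : ℕ) (hb : 1 ≤ b)
    (hr : ∀ u b : ℕ, 1 ≤ b → chaosNode m b = (m ^ r * u + 1, 1) →
      chaosNode m (b + treeSize m r) = (u + 1, r + 1))
    (h : chaosNode m b = (m ^ (r + 1) * u + 1, 1)) (s : ℕ) (hs : s < m) :
    chaosNode m (b + s * (treeSize m r + 1)) = (m ^ r * (m * u + s) + 1, 1) := by
  induction s with
  | zero => simpa [pow_succ, mul_assoc] using h
  | succ s ih =>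
    have hroot := hr (m * u + s) _ (by omega) (ih (by omega))
    have hnd : (m * u + s + 1) % m ≠ 0 := by
      rw [add_assoc, Nat.mul_add_mod, Nat.mod_eq_of_lt hs]
      omega
    have he : b + (s + 1) * (treeSize m r + 1) =
        b + s * (treeSize m r + 1) + treeSize m r + 1 := by ring
    rw [he, chaosNode_succ m _ (by omega), hroot, chaosNext, if_pos hnd, Nat.add_sub_cancel,
      add_assoc (m * u)]

/-- The subtree below `(u + 1, r + 1)` is enumerated without interruption: it starts at its
leftmost leaf `(m ^ r * u + 1, 1)` and ends at its root. -/
theorem chaosNode_add_treeSize (m : ℕ) (hm : 1 ≤ m) (r : ℕ) : ∀ u b : ℕ, 1 ≤ b →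
    chaosNode m b = (m ^ r * u + 1, 1) → chaosNode m (b + treeSize m r) = (u + 1, r + 1) := by
  induction r with
  | zero =>
    intro u b _ h
    simpa [treeSize] using h
  | succ r ih =>
    intro u b hb h
    obtain ⟨q, rfl⟩ := Nat.exists_eq_add_of_le' hm
    have hroot := ih ((q + 1) * u + q) _ (by omega)
      (chaosNode_child_leaf (q + 1) r u b hb ih h q (by omega))
    have he : b + treeSize (q + 1) (r + 1) =
        b + q * (treeSize (q + 1) r + 1) + treeSize (q + 1) r + 1 := by
      rw [treeSize]; ring
    have hmul : (q + 1) * u + q + 1 = (q + 1) * (u + 1) := by ring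
    rw [he, chaosNode_succ _ _ (by omega), hroot, hmul]
    simp [chaosNext]

/-! ### The recursion of the chaos game -/

/-- The index of the `t`-th argument in the recursion for `x_i`, `i ≥ 1`, so that
`x_i = f_{γ_i} (x_{c 0}, …, x_{c (m - 1)})` with `c t = chaosChild m i t`. The start `x₀` has
index `0`. -/
noncomputable def chaosChild (m i t : ℕ) : ℕ :=
  if i ≤ m then 0
  else if 1 < (chaosNode m i).2 then
    chaosH m (m * (chaosNode m i).1 - m + 1 + t) ((chaosNode m i).2 - 1)
  else Nat.findGreatest (fun l => 1 < (chaosNode m l).2) (i - 1)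

theorem chaosSeq_zero {X : Type*} {m n : ℕ} (f : Fin n → (Fin m → X) → X) (x₀ : X)
    (γ : ℕ → Fin n) : chaosSeq f x₀ γ 0 = x₀ := by
  rw [chaosSeq, dif_pos rfl]

theorem chaosSeq_of_pos {X : Type*} {m n : ℕ} (f : Fin n → (Fin m → X) → X) (x₀ : X)
    (γ : ℕ → Fin n) {i : ℕ} (hi : 1 ≤ i) :
    chaosSeq f x₀ γ i = f (γ i) fun t => chaosSeq f x₀ γ (chaosChild m i t) := by
  conv_lhs => rw [chaosSeq]
  rw [dif_neg (by omega)]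
  simp only [chaosChild]
  by_cases him : i ≤ m
  · simp only [if_pos him, chaosSeq_zero]
  · by_cases hk : 1 < (chaosNode m i).2
    · simp only [if_neg him, dif_pos hk, if_pos hk]
    · simp only [if_neg him, dif_neg hk, if_neg hk]

theorem chaosChild_lt (m i t : ℕ) (ht : t < m) (hi : 1 ≤ i) : chaosChild m i t < i := by
  unfold chaosChild
  split_ifs with h1 h2
  · omega
  · exact chaosH_child_lt m i t ht hi h2
  · exact lt_of_le_of_lt (Nat.findGreatest_le _) (by omega)

theorem chaosChild_of_node (m i u k t : ℕ) (hi : m < i) (h : chaosNode m i = (u + 1, k + 2)) :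
    chaosChild m i t = chaosH m (m * u + 1 + t) (k + 1) := by
  have he : m * (u + 1) - m = m * u := by rw [mul_add, mul_one, Nat.add_sub_cancel]
  simp [chaosChild, not_le.2 hi, h, he]

/-- The arguments of `x_i` have large indices when `i` is large. For a leaf this is because there
are infinitely many inner nodes, and for an inner node because a child has only one parent. -/
theorem tendsto_chaosChild (m t : ℕ) (ht : t < m) :
    Tendsto (fun i => chaosChild m i t) atTop atTop := by
  have hm : 1 ≤ m := by omega
  refine tendsto_atTop.2 fun M => ?_
  have hfin : {i | m < i ∧ 1 < (chaosNode m i).2 ∧ chaosChild m i t < M}.Finite := by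
    refine Finite.of_injOn (f := fun i => chaosChild m i t) (t := Iio M) (fun i hi => hi.2.2) ?_
      (finite_Iio M)
    rintro i ⟨hi, hk, -⟩ i' ⟨hi', hk', -⟩ heq
    obtain ⟨u, k, h⟩ := chaosNode_eq m hm i (by omega)
    obtain ⟨u', k', h'⟩ := chaosNode_eq m hm i' (by omega)
    rw [h] at hk
    rw [h'] at hk'
    obtain ⟨k, rfl⟩ : ∃ l, k = l + 1 := ⟨k - 1, by dsimp only at hk; omega⟩
    obtain ⟨k', rfl⟩ : ∃ l, k' = l + 1 := ⟨k' - 1, by dsimp only at hk'; omega⟩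
    dsimp only at heq
    rw [chaosChild_of_node m i u k t hi h, chaosChild_of_node m i' u' k' t hi' h'] at heq
    have h1 := (chaosNode_chaosH_child m i u k t ht (by omega) h).2
    rw [heq, (chaosNode_chaosH_child m i' u' k' t ht (by omega) h').2] at h1
    obtain ⟨hu, hk⟩ := Prod.mk.inj h1
    obtain rfl : u = u' := Nat.eq_of_mul_eq_mul_left hm (by omega)
    obtain rfl : k = k' := by omega
    exact chaosNode_injOn m hm (mem_Ici.2 (by omega)) (mem_Ici.2 (by omega)) (h.trans h'.symm)
  have hsize : ∀ r, r ≤ treeSize m r := fun r => (strictMono_treeSize m hm).le_apply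
  have hinner : chaosNode m (1 + treeSize m (M + 1)) = (1, M + 2) :=
    chaosNode_add_treeSize m hm (M + 1) 0 1 le_rfl (by simp [chaosNode_one])
  have hev : ∀ᶠ i in atTop, i ∉ {i | m < i ∧ 1 < (chaosNode m i).2 ∧ chaosChild m i t < M} := by
    rw [← Nat.cofinite_eq_atTop]
    exact hfin.eventually_cofinite_notMem
  filter_upwards [hev, eventually_gt_atTop m, eventually_gt_atTop (1 + treeSize m (M + 1))]
    with i h1 h2 h3
  by_cases hk : 1 < (chaosNode m i).2
  · by_contra! hlt
    exact h1 ⟨h2, hk, hlt⟩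
  · rw [chaosChild, if_neg (not_le.2 h2), if_neg hk]
    have hle := Nat.le_findGreatest (P := fun l => 1 < (chaosNode m l).2)
      (m := 1 + treeSize m (M + 1)) (n := i - 1) (by omega) (by rw [hinner]; dsimp only; omega)
    have := hsize (M + 1)
    omega

/-- The indices `b, …, b + treeSize m r` carry a complete `m`-ary tree of height `r` for the child
relation of the chaos game, with root `b + treeSize m r` and with the subtrees of the root
one after another. The arguments at its leaves are arbitrary. -/
def IsTreeBlock (m : ℕ) : ℕ → ℕ → Prop
  | 0, b => 1 ≤ b
  | r + 1, b => ∀ t < m,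
      chaosChild m (b + treeSize m (r + 1)) t = b + t * (treeSize m r + 1) + treeSize m r ∧
        IsTreeBlock m r (b + t * (treeSize m r + 1))

theorem isTreeBlock_of_leaf (m : ℕ) (hm : 1 ≤ m) (r : ℕ) : ∀ u b : ℕ, 1 ≤ b →
    chaosNode m b = (m ^ r * u + 1, 1) → IsTreeBlock m r b := by
  induction r with
  | zero => exact fun u b hb _ => hb
  | succ r ih =>
    intro u b hb h t ht
    have hleaf := chaosNode_child_leaf m r u b hb (chaosNode_add_treeSize m hm r) h t ht
    refine ⟨?_, ih _ _ (by omega) hleaf⟩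
    have hchild := chaosNode_add_treeSize m hm r _ _ (by omega) hleaf
    have hsize : m ≤ treeSize m (r + 1) := Nat.le_mul_of_pos_right m (Nat.succ_pos _)
    rw [chaosChild_of_node m _ u r t (by omega) (chaosNode_add_treeSize m hm (r + 1) u b hb h)]
    exact chaosH_eq m hm (by omega) (by rw [hchild]; congr 1; omega)

theorem treeSize_one (r : ℕ) : treeSize 1 r = r := by
  induction r with
  | zero => rfl
  | succ r ih => rw [treeSize, ih, one_mul]

/-- For `m = 1` the chaos game is the classical one, `x_i = f_{γ_i} (x_{i - 1})`. -/
theorem chaosChild_one (i : ℕ) : chaosChild 1 (i + 1) 0 = i := by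
  have hnode : ∀ i, chaosNode 1 (1 + i) = (1, i + 1) := fun i => by
    have h := chaosNode_add_treeSize 1 le_rfl i 0 1 le_rfl (by simp [chaosNode_one])
    rwa [treeSize_one] at h
  cases i with
  | zero => simp [chaosChild]
  | succ i =>
    rw [chaosChild_of_node 1 _ 0 i 0 (by omega) (by rw [add_comm, hnode]; simp [add_comm])]
    exact chaosH_eq 1 le_rfl (by omega) (by rw [add_comm, hnode]; simp [add_comm])

theorem isTreeBlock_one (r : ℕ) : ∀ b : ℕ, 1 ≤ b → IsTreeBlock 1 r b := by
  induction r with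
  | zero => exact fun b hb => hb
  | succ r ih =>
    intro b hb t ht
    obtain rfl : t = 0 := by omega
    rw [zero_mul, add_zero, treeSize_one, treeSize_one, ← add_assoc, chaosChild_one]
    exact ⟨rfl, ih b hb⟩

theorem exists_strictMono_isTreeBlock (m : ℕ) (hm : 1 ≤ m) (r : ℕ) :
    ∃ b : ℕ → ℕ, StrictMono b ∧ ∀ s, IsTreeBlock m r (b s) := by
  rcases eq_or_lt_of_le hm with rfl | hm2
  · exact ⟨fun s => s + 1, fun _ _ h => Nat.add_lt_add_right h 1,
      fun s => isTreeBlock_one r _ (Nat.le_add_left 1 s)⟩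
  -- The leaf enumerated just after the node `(1, s + r + 1)` is `(m ^ (s + r) + 1, 1)`.
  refine ⟨fun s => 1 + treeSize m (s + r) + 1, fun s s' h => ?_, fun s => ?_⟩
  · have := strictMono_treeSize m hm (Nat.add_lt_add_right h r)
    dsimp only
    omega
  · have hroot := chaosNode_add_treeSize m hm (s + r) 0 1 le_rfl (by simp [chaosNode_one])
    refine isTreeBlock_of_leaf m hm r (m ^ s) _ (Nat.le_add_left 1 _) ?_
    rw [chaosNode_succ m _ (Nat.le_add_right 1 _), hroot]
    simp [chaosNext, Nat.mod_eq_of_lt hm2, pow_add, mul_comm]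

/-! ### Words in the random symbol sequence -/

section Words

variable {n : ℕ}

/-- The sequences that spell the first `N` letters of the word `v` from the position `b` on. -/
def spells (v : ℕ → Fin n) (N b : ℕ) : Set (ℕ → Fin n) :=
  {γ | ∀ o < N, γ (b + o) = v o}

theorem spells_eq_pi (v : ℕ → Fin n) (N b : ℕ) :
    spells v N b = Set.pi (Finset.Ico b (b + N)) fun i => {v (i - b)} := by
  ext γ
  simp only [spells, mem_ofPred_eq, Set.mem_pi, Finset.coe_Ico, mem_Ico, mem_singleton_iff]
  refine ⟨fun h i hi => ?_, fun h o ho => ?_⟩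
  · have := h (i - b) (by omega)
    rwa [Nat.add_sub_cancel' hi.1] at this
  · have := h (b + o) (by omega)
    rwa [Nat.add_sub_cancel_left] at this

theorem measurableSet_spells (v : ℕ → Fin n) (N b : ℕ) : MeasurableSet (spells v N b) := by
  rw [spells_eq_pi]
  exact MeasurableSet.pi (Finset.countable_toSet _) fun _ _ => measurableSet_singleton _

theorem infinitePi_spells (p : PMF (Fin n)) (v : ℕ → Fin n) (N b : ℕ) :
    Measure.infinitePi (fun _ : ℕ => p.toMeasure) (spells v N b) =
      ∏ o ∈ Finset.range N, p (v o) := by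
  rw [spells_eq_pi, Measure.infinitePi_pi _ fun _ _ => measurableSet_singleton _,
    Finset.prod_Ico_eq_prod_range]
  simp

theorem iIndepSet_spells (p : PMF (Fin n)) (v : ℕ → Fin n) (N : ℕ) {b : ℕ → ℕ}
    (hb : ∀ s, b s + N ≤ b (s + 1)) :
    ProbabilityTheory.iIndepSet (fun s => spells v N (b s))
      (Measure.infinitePi fun _ : ℕ => p.toMeasure) := by
  rw [ProbabilityTheory.iIndepSet_iff_meas_biInter fun s => measurableSet_spells v N (b s)]
  intro S
  have hmono : Monotone b := monotone_nat_of_le_succ fun s => (Nat.le_add_right _ _).trans (hb s)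
  have hsep : ∀ {s s' i : ℕ}, i ∈ Finset.Ico (b s) (b s + N) →
      i ∈ Finset.Ico (b s') (b s' + N) → s' ≤ s := by
    intro s s' i hi hi'
    by_contra! hlt
    have h1 := hb s
    have h2 := hmono (Nat.add_one_le_of_lt hlt)
    simp only [Finset.mem_Ico] at hi hi'
    omega
  have hdisj : (S : Set ℕ).PairwiseDisjoint fun s => Finset.Ico (b s) (b s + N) := by
    intro s _ s' _ hne
    refine Finset.disjoint_left.2 fun i hi hi' => hne ?_
    exact le_antisymm (hsep hi' hi) (hsep hi hi')
  -- On the union of the windows, the window of `i` tells the letter required at `i`.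
  have hletter : ∀ i, ∃ c : Fin n, ∀ s, i ∈ Finset.Ico (b s) (b s + N) → v (i - b s) = c := by
    intro i
    by_cases h : ∃ s, i ∈ Finset.Ico (b s) (b s + N)
    · obtain ⟨s, hs⟩ := h
      refine ⟨v (i - b s), fun s' hs' => ?_⟩
      rw [le_antisymm (hsep hs' hs) (hsep hs hs')]
    · exact ⟨v 0, fun s hs => absurd ⟨s, hs⟩ h⟩
  choose c hc using hletter
  have hpi : ∀ s, spells v N (b s) = Set.pi (Finset.Ico (b s) (b s + N)) fun i => {c i} := by
    intro s
    rw [spells_eq_pi]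
    exact Set.pi_congr rfl fun i hi => by rw [hc i s (Finset.mem_coe.1 hi)]
  have hinter : ⋂ s ∈ S, spells v N (b s) =
      Set.pi (S.biUnion fun s => Finset.Ico (b s) (b s + N)) fun i => {c i} := by
    ext γ
    simp only [hpi, mem_iInter, Set.mem_pi, Finset.mem_coe, Finset.mem_biUnion]
    exact ⟨fun h i ⟨s, hs, hi⟩ => h s hs i hi, fun h s hs i hi => h i ⟨s, hs, hi⟩⟩
  rw [hinter, Measure.infinitePi_pi _ fun _ _ => measurableSet_singleton _,
    Finset.prod_biUnion hdisj]
  refine Finset.prod_congr rfl fun s _ => ?_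
  rw [hpi, Measure.infinitePi_pi _ fun _ _ => measurableSet_singleton _]

/-- By the second Borel–Cantelli lemma, a word of letters of positive probability almost surely
appears at infinitely many of the positions `b 0 < b 1 < …`. -/
theorem ae_frequently_spells (p : PMF (Fin n)) (hp : ∀ i, 0 < p i) (v : ℕ → Fin n) {N : ℕ}
    (hN : 1 ≤ N) {b : ℕ → ℕ} (hb : StrictMono b) :
    ∀ᵐ γ ∂(Measure.infinitePi fun _ : ℕ => p.toMeasure),
      ∃ᶠ s in atTop, γ ∈ spells v N (b s) := by
  -- Along the multiples of `N` the windows are disjoint.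
  have hgap : ∀ s, b (N * s) + N ≤ b (N * (s + 1)) := fun s => by
    have h := hb.add_le_nat N (N * s)
    rwa [add_comm, mul_add, mul_one, add_comm (N * s)]
  have hind := iIndepSet_spells p v N hgap
  have hlimsup := ProbabilityTheory.measure_limsup_eq_one
    (fun s => measurableSet_spells v N (b (N * s))) hind (by
      simp only [infinitePi_spells]
      refine ENNReal.tsum_const_eq_top_of_ne_zero ?_
      exact Finset.prod_ne_zero_iff.2 fun o _ => (hp _).ne')
  have hmeas : MeasurableSet (limsup (fun s => spells v N (b (N * s))) atTop) :=
    MeasurableSet.measurableSet_limsup fun s => measurableSet_spells v N (b (N * s))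
  filter_upwards [(mem_ae_iff_prob_eq_one hmeas).2 hlimsup] with γ hγ
  rw [limsup_eq_iInf_iSup_of_nat] at hγ
  refine frequently_atTop.2 fun M => ?_
  simp only [iInf_eq_iInter, iSup_eq_iUnion, mem_iInter, mem_iUnion] at hγ
  obtain ⟨s, hs, h⟩ := hγ M
  exact ⟨N * s, hs.trans (Nat.le_mul_of_pos_left s hN), h⟩

end Words

/-! ### Convergence of the chaos game -/

section ChaosGame

variable {X : Type*} [MetricSpace X] {m n : ℕ} {f : Fin n → (Fin m → X) → X} {φ : ℝ≥0 → ℝ≥0}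
  {A : Set X}

theorem exists_nndist_chaosSeq_le (hφ : IsMatkowskiFun φ)
    (hf : ∀ i x y, nndist (f i x) (f i y) ≤ φ (nndist x y)) (hA : A = gifsMap f fun _ => A)
    (x₀ : X) (γ : ℕ → Fin n) {c : ℝ≥0} {i : ℕ} (hi : 1 ≤ i)
    (h : ∀ t : Fin m, ∃ a ∈ A, nndist (chaosSeq f x₀ γ (chaosChild m i t)) a ≤ c) :
    ∃ a ∈ A, nndist (chaosSeq f x₀ γ i) a ≤ φ c := by
  rw [chaosSeq_of_pos f x₀ γ hi]
  choose a ha hac using h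
  refine ⟨f (γ i) a, ?_, (hf _ _ _).trans (hφ.mono (nndist_pi_le_iff.2 hac))⟩
  rw [hA]
  exact mem_iUnion.2 ⟨γ i, mem_image_of_mem _ fun t _ => ha t⟩

theorem exists_nndist_chaosSeq_le_start (hφ : IsMatkowskiFun φ)
    (hf : ∀ i x y, nndist (f i x) (f i y) ≤ φ (nndist x y)) (hA : A = gifsMap f fun _ => A)
    {x₀ : X} {c : ℝ≥0} (h0 : ∃ a ∈ A, nndist x₀ a ≤ c) (γ : ℕ → Fin n) (i : ℕ) :
    ∃ a ∈ A, nndist (chaosSeq f x₀ γ i) a ≤ c := by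
  induction i using Nat.strong_induction_on with
  | _ i ih =>
    rcases Nat.eq_zero_or_pos i with rfl | hi
    · rwa [chaosSeq_zero]
    · obtain ⟨a, ha, h⟩ := exists_nndist_chaosSeq_le hφ hf hA x₀ γ hi
        fun t => ih _ (chaosChild_lt m i t t.isLt hi)
      exact ⟨a, ha, h.trans (hφ.le_self c)⟩

/-- The chaos game approaches the attractor along every symbol sequence. -/
theorem eventually_exists_nndist_chaosSeq_lt (hφ : IsMatkowskiFun φ)
    (hf : ∀ i x y, nndist (f i x) (f i y) ≤ φ (nndist x y)) (hA : A = gifsMap f fun _ => A)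
    (hne : A.Nonempty) (x₀ : X) (γ : ℕ → Fin n) {ε : ℝ≥0} (hε : 0 < ε) :
    ∀ᶠ i in atTop, ∃ a ∈ A, nndist (chaosSeq f x₀ γ i) a < ε := by
  obtain ⟨a₀, ha₀⟩ := hne
  have key : ∀ k : ℕ, ∀ᶠ i in atTop,
      ∃ a ∈ A, nndist (chaosSeq f x₀ γ i) a ≤ φ^[k] (nndist x₀ a₀) := by
    intro k
    induction k with
    | zero =>
      exact Eventually.of_forall
        (exists_nndist_chaosSeq_le_start hφ hf hA ⟨a₀, ha₀, le_rfl⟩ γ)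
    | succ k ih =>
      have hall := eventually_all.2 fun t : Fin m => (tendsto_chaosChild m t t.isLt).eventually ih
      filter_upwards [hall, eventually_ge_atTop 1] with i h hi
      rw [Function.iterate_succ_apply']
      exact exists_nndist_chaosSeq_le hφ hf hA x₀ γ hi h
  obtain ⟨k, hk⟩ := ((hφ.tendsto_iterate' (nndist x₀ a₀)).eventually (gt_mem_nhds hε)).exists
  filter_upwards [key k] with i ⟨a, ha, h⟩ using ⟨a, ha, h.trans_lt hk⟩

/-- A point of the attractor has, for each height `r`, an address: a word such that whenever the
symbols along a tree block of height `r` spell it, the root of the block is close to the point.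
In post-order, the words of the subtrees come first and the symbol of the root comes last. -/
theorem exists_word (hm : 1 ≤ m) (hφ : IsMatkowskiFun φ)
    (hf : ∀ i x y, nndist (f i x) (f i y) ≤ φ (nndist x y)) (hA : A = gifsMap f fun _ => A)
    (x₀ : X) {D : ℝ≥0} (hD : ∀ γ : ℕ → Fin n, ∀ i, ∀ a ∈ A, nndist (chaosSeq f x₀ γ i) a ≤ D)
    (r : ℕ) : ∀ a ∈ A, ∃ v : ℕ → Fin n, ∀ γ b, IsTreeBlock m r b →
      γ ∈ spells v (treeSize m r + 1) b →
      nndist (chaosSeq f x₀ γ (b + treeSize m r)) a ≤ φ^[r + 1] D := by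
  have hstep : ∀ a ∈ A, ∃ q : Fin n, ∃ u : Fin m → X, (∀ t, u t ∈ A) ∧ f q u = a := by
    intro a ha
    rw [hA] at ha
    obtain ⟨q, u, hu, h⟩ := mem_iUnion.1 ha
    exact ⟨q, u, fun t => hu t trivial, h⟩
  have hroot : ∀ γ i q u (c : ℝ≥0), 1 ≤ i → γ i = q →
      (∀ t : Fin m, nndist (chaosSeq f x₀ γ (chaosChild m i t)) (u t) ≤ c) →
      nndist (chaosSeq f x₀ γ i) (f q u) ≤ φ c := by
    rintro γ i _ u c hi rfl h
    rw [chaosSeq_of_pos f x₀ γ hi]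
    exact (hf _ _ _).trans (hφ.mono (nndist_pi_le_iff.2 h))
  induction r with
  | zero =>
    intro a ha
    obtain ⟨q, u, hu, rfl⟩ := hstep a ha
    exact ⟨fun _ => q, fun γ b hb hγ =>
      hroot γ b q u D hb (hγ 0 (Nat.succ_pos _)) fun t => hD γ _ _ (hu t)⟩
  | succ r ih =>
    intro a ha
    obtain ⟨q, u, hu, rfl⟩ := hstep a ha
    choose w hw using fun t => ih (u t) (hu t)
    set W := treeSize m r + 1
    refine ⟨fun o => if h : o / W < m then w ⟨o / W, h⟩ (o % W) else q, fun γ b hb hγ => ?_⟩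
    have hWpos : 0 < W := Nat.succ_pos _
    rw [Function.iterate_succ_apply']
    refine hroot γ _ q u _ ?_ ?_ fun t => ?_
    · have : m ≤ treeSize m (r + 1) := Nat.le_mul_of_pos_right m (Nat.succ_pos _)
      omega
    · rw [hγ _ (Nat.lt_succ_self _)]
      have hdiv : treeSize m (r + 1) / W = m := Nat.mul_div_cancel m hWpos
      simp [hdiv]
    · obtain ⟨hchild, hblock⟩ := hb t t.isLt
      rw [hchild]
      refine hw t γ _ hblock fun o ho => ?_
      have hlt : t * W + o < treeSize m (r + 1) := by
        calc t * W + o < t * W + W := Nat.add_lt_add_left ho _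
          _ = (t + 1) * W := by ring
          _ ≤ m * W := Nat.mul_le_mul_right W t.isLt
      have hdiv : (t * W + o) / W = t := by
        rw [mul_comm, Nat.mul_add_div hWpos, Nat.div_eq_of_lt ho, add_zero]
      have hmod : (t * W + o) % W = o := by
        rw [mul_comm, Nat.mul_add_mod, Nat.mod_eq_of_lt ho]
      rw [add_assoc, hγ _ (hlt.trans (Nat.lt_succ_self _))]
      simp [hdiv, hmod]

/-- Almost surely every point of the attractor is an accumulation point of the chaos game. Only
countably many words are involved, so one null set serves all points of the attractor. -/
theorem ae_subset_chaosTail (hm : 1 ≤ m) (hφ : IsMatkowskiFun φ)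
    (hf : ∀ i x y, nndist (f i x) (f i y) ≤ φ (nndist x y)) (hA : IsGIFSAttractor f A)
    (p : PMF (Fin n)) (hp : ∀ i, 0 < p i) (x₀ : X) :
    ∀ᵐ γ ∂(Measure.infinitePi fun _ : ℕ => p.toMeasure),
      ∀ k, A ⊆ chaosTail (chaosSeq f x₀ γ) k := by
  obtain ⟨⟨a₀, ha₀⟩, hcpt, hfix⟩ := hA
  obtain ⟨D, hD⟩ : ∃ D : ℝ≥0, ∀ γ : ℕ → Fin n, ∀ i, ∀ a ∈ A,
      nndist (chaosSeq f x₀ γ i) a ≤ D := by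
    obtain ⟨C, hC⟩ := Metric.isBounded_iff_nndist.1 hcpt.isBounded
    refine ⟨nndist x₀ a₀ + C, fun γ i a ha => ?_⟩
    obtain ⟨a', ha', h⟩ :=
      exists_nndist_chaosSeq_le_start hφ hf hfix ⟨a₀, ha₀, le_rfl⟩ γ i
    exact (nndist_triangle _ a' _).trans (add_le_add h (hC ha' ha))
  choose b hbmono hb using exists_strictMono_isTreeBlock m hm
  have hwords : ∀ᵐ γ ∂(Measure.infinitePi fun _ : ℕ => p.toMeasure),
      ∀ r, ∀ w : Fin (treeSize m r + 1) → Fin n,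
        ∃ᶠ s in atTop, γ ∈ spells (fun o => w (Fin.ofNat _ o)) (treeSize m r + 1) (b r s) :=
    ae_all_iff.2 fun r => ae_all_iff.2 fun w =>
      ae_frequently_spells p hp _ (Nat.succ_pos _) (hbmono r)
  filter_upwards [hwords] with γ hγ k a ha
  refine Metric.mem_closure_iff.2 fun ε hε => ?_
  lift ε to ℝ≥0 using hε.le
  obtain ⟨r, hr⟩ := (((tendsto_add_atTop_iff_nat 1).2 (hφ.tendsto_iterate' D)).eventually
    (gt_mem_nhds (show (0 : ℝ≥0) < ε by exact_mod_cast hε))).exists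
  obtain ⟨v, hv⟩ := exists_word hm hφ hf hfix x₀ hD r a ha
  obtain ⟨s, hsk, hs⟩ := frequently_atTop.1 (hγ r fun o => v o) k
  have hspell : γ ∈ spells v (treeSize m r + 1) (b r s) := fun o ho => by
    simpa [Nat.mod_eq_of_lt ho] using hs o ho
  refine ⟨_, ⟨b r s + treeSize m r, ?_, rfl⟩, ?_⟩
  · have := (hbmono r).le_apply (x := s)
    omega
  · rw [dist_comm]
    exact_mod_cast (hv γ _ (hb r s) hspell).trans_lt hr

theorem isCompact_chaosTail [CompleteSpace X] {x : ℕ → X} (hA : IsCompact A)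
    (h : ∀ ε : ℝ≥0, 0 < ε → ∀ᶠ i in atTop, ∃ a ∈ A, nndist (x i) a < ε) (k : ℕ) :
    IsCompact (chaosTail x k) := by
  refine (TotallyBounded.closure ?_).isCompact_of_isClosed isClosed_closure
  refine TotallyBounded.subset (s₂ := range x) ?_ ?_
  · rintro _ ⟨i, -, rfl⟩
    exact mem_range_self i
  refine Metric.totallyBounded_iff.2 fun ε hε => ?_
  lift ε to ℝ≥0 using hε.le
  obtain ⟨T, hT, hAT⟩ := Metric.totallyBounded_iff.1 hA.totallyBounded (ε / 2) (half_pos hε)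
  obtain ⟨N, hN⟩ := eventually_atTop.1 (h (ε / 2) (half_pos (by exact_mod_cast hε)))
  refine ⟨T ∪ x '' Iio N, hT.union ((finite_Iio N).image x), ?_⟩
  rintro _ ⟨i, rfl⟩
  rcases lt_or_ge i N with hi | hi
  · exact mem_iUnion₂.2 ⟨x i, Or.inr (mem_image_of_mem x hi), Metric.mem_ball_self hε⟩
  · obtain ⟨a, ha, hxa⟩ := hN i hi
    obtain ⟨z, hz, haz⟩ := mem_iUnion₂.1 (hAT ha)
    refine mem_iUnion₂.2 ⟨z, Or.inl hz, ?_⟩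
    have hxa' : dist (x i) a < ε / 2 := by exact_mod_cast hxa
    have haz' : dist a z < ε / 2 := haz
    rw [Metric.mem_ball]
    linarith [dist_triangle (x i) a z]

theorem tendsto_hausdorffEDist_chaosTail {x : ℕ → X}
    (h : ∀ ε : ℝ≥0, 0 < ε → ∀ᶠ i in atTop, ∃ a ∈ A, nndist (x i) a < ε)
    (hsub : ∀ k, A ⊆ chaosTail x k) :
    Tendsto (fun k => Metric.hausdorffEDist (chaosTail x k) A) atTop (𝓝 0) := by
  refine ENNReal.tendsto_nhds_zero.2 fun ε hε => ?_
  obtain ⟨δ, hδ, hδε⟩ := ENNReal.lt_iff_exists_nnreal_btwn.1 hε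
  obtain ⟨N, hN⟩ := eventually_atTop.1 (h δ (by exact_mod_cast hδ))
  filter_upwards [eventually_ge_atTop N] with k hk
  refine le_trans ?_ hδε.le
  rw [chaosTail, Metric.hausdorffEDist_closure_left]
  refine Metric.hausdorffEDist_le_of_infEDist ?_ fun a ha => ?_
  · rintro _ ⟨i, hi, rfl⟩
    obtain ⟨a, ha, hxa⟩ := hN i (hk.trans hi)
    refine (Metric.infEDist_le_edist_of_mem ha).trans ?_
    rw [edist_nndist]
    exact_mod_cast hxa.le
  · rw [Metric.mem_closure_iff_infEDist_zero.1 (hsub k ha)]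
    exact zero_le

end ChaosGame

theorem theorem3p1 {X : Type*} [MetricSpace X] [CompleteSpace X]
    (m n : ℕ) (hm : 1 ≤ m)
    (f : Fin n → (Fin m → X) → X) (hf : ∀ i, IsGenMatkowskiContraction (f i))
    (p : PMF (Fin n)) (hp : ∀ i, 0 < p i) (x₀ : X) :
    ∃ A : Set X, IsGIFSAttractor f A ∧ (∀ B : Set X, IsGIFSAttractor f B → B = A) ∧
      ∀ᵐ γ ∂(Measure.infinitePi (fun _ : ℕ => p.toMeasure)),
        (∀ k : ℕ, IsCompact (chaosTail (chaosSeq f x₀ γ) k)) ∧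
        Tendsto (fun k : ℕ => Metric.hausdorffEDist (chaosTail (chaosSeq f x₀ γ) k) A)
          atTop (𝓝 0) ∧
        (x₀ ∈ A → ∀ k : ℕ, chaosTail (chaosSeq f x₀ γ) k = A) := by
  obtain ⟨φ, hφ, hle⟩ := exists_common_comparison hf
  have hX : Nonempty X := ⟨x₀⟩
  have hn : NeZero n := by
    obtain ⟨i, -⟩ := p.support_nonempty
    exact ⟨fun h => (h ▸ i).elim0⟩
  obtain ⟨A, hA, huniq⟩ := exists_unique_attractor hφ hle
  refine ⟨A, hA, huniq, ?_⟩
  filter_upwards [ae_subset_chaosTail hm hφ hle hA p hp x₀] with γ hsub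
  have hnear : ∀ ε : ℝ≥0, 0 < ε → ∀ᶠ i in atTop, ∃ a ∈ A, nndist (chaosSeq f x₀ γ i) a < ε :=
    fun ε hε => eventually_exists_nndist_chaosSeq_lt hφ hle hA.2.2 hA.1 x₀ γ hε
  refine ⟨isCompact_chaosTail hA.2.1 hnear, tendsto_hausdorffEDist_chaosTail hnear hsub,
    fun hx₀ k => (closure_minimal ?_ hA.2.1.isClosed).antisymm (hsub k)⟩
  rintro _ ⟨i, -, rfl⟩
  obtain ⟨a, ha, h⟩ := exists_nndist_chaosSeq_le_start hφ hle hA.2.2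
    ⟨x₀, hx₀, (nndist_self x₀).le⟩ γ i
  rwa [nndist_eq_zero.1 (le_antisymm h zero_le)]
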